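/- All rings are commutative with $1$. An ideal $I$ of a ring $R$ is locally principal if there are finitely many elements $s_1,\dots,s_n\in R$ with $\langle s_1,\dots,s_n\rangle=R$ such that $I\,R[1/s_i]$ is a principal ideal of $R[1/s_i]$ for every $i$. A ring is arithmetic if each of its finitely generated ideals is locally principal, and a Prüfer ring is a ring that is arithmetic and reduced (it need not be a domain). Let $R$ be a Prüfer ring of Krull dimension at most $1$ and let $f\in R[X]$ be a monic polynomial. Let $S=R[X]/\langle f\rangle$, let $x\in S$ be the class of $X$, let $f'$ be the formal derivative of $f$, and let $R_{\{f\}}=S[1/f'(x)]$. Then $R_{\{f\}}$ is also a Prüfer ring of Krull dimension at most $1$. -/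

import Mathlib

/-- An ideal `I` is locally principal if there are finitely many comaximal elements `s₁, …, sₙ`
of `R` such that `I` becomes principal in each localization `R[1/sᵢ]`. -/
def Ideal.IsLocallyPrincipal {R : Type*} [CommRing R] (I : Ideal R) : Prop :=
  ∃ s : Finset R, Ideal.span (s : Set R) = ⊤ ∧
    ∀ a ∈ s, (I.map (algebraMap R (Localization.Away a))).IsPrincipal

/-- An arithmetic ring: every finitely generated ideal is locally principal. -/
def IsArithmeticRing (R : Type*) [CommRing R] : Prop :=
  ∀ I : Ideal R, I.FG → I.IsLocallyPrincipal

/-- A Prüfer ring: a reduced arithmetic ring (not necessarily a domain). -/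
structure IsPruferRing (R : Type*) [CommRing R] : Prop where
  isReduced : IsReduced R
  isArithmetic : IsArithmeticRing R

/-- The ring `R_{f} = S[1/f'(x)]`, where `S = R[X]/⟨f⟩` and `x` is the class of `X` in `S`. -/
abbrev LocalizedRootAlgebra {R : Type*} [CommRing R] (f : Polynomial R) : Type _ :=
  Localization.Away (Polynomial.aeval (AdjoinRoot.root f) (Polynomial.derivative f))

open Polynomial

/-! A ring is Prüfer exactly when all its ideals are flat. A reduced local Bézout ring is a domain,
over which flat means torsion-free; so over a Prüfer ring, checking at maximal ideals, submodules of
flat modules are flat. Conversely, if all ideals are flat, finitely generated ideals of the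
localizations are free, hence principal, and no nonzero element there squares to zero.

Inverting `f'(x)` makes `R_{f}` étale over `R`. Its ideals are `R`-submodules of a flat `R`-module,
hence `R`-flat, and unramifiedness upgrades this to flatness over `R_{f}`. The dimension bound holds
because étale algebras are quasi-finite. -/

namespace Ideal

/-- A locally principal ideal becomes principal in the localization at any prime. -/
theorem IsLocallyPrincipal.isPrincipal_map_atPrime {R : Type*} [CommRing R] {I : Ideal R}
    (hI : I.IsLocallyPrincipal) (p : Ideal R) [p.IsPrime] :
    (I.map (algebraMap R (Localization.AtPrime p))).IsPrincipal := by
  obtain ⟨s, hs, h⟩ := hI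
  obtain ⟨a, has, hap⟩ : ∃ a ∈ s, a ∉ p := by
    by_contra! H
    exact ‹p.IsPrime›.ne_top (top_le_iff.mp (hs ▸ Ideal.span_le.mpr H))
  obtain ⟨g, hg⟩ := h a has
  have hu : IsUnit (algebraMap R (Localization.AtPrime p) a) :=
    IsLocalization.map_units (M := p.primeCompl) _ ⟨a, hap⟩
  let φ : Localization.Away a →+* Localization.AtPrime p := IsLocalization.Away.lift a hu
  have hφ : φ.comp (algebraMap R (Localization.Away a)) =
      algebraMap R (Localization.AtPrime p) := IsLocalization.Away.lift_comp a hu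
  refine ⟨φ g, ?_⟩
  rw [← hφ, ← Ideal.map_map, hg, ← Ideal.span, Ideal.map_span, Set.image_singleton]

/-- If multiples of a finitely generated ideal lie in principal subideals, for a set of
multipliers contained in no maximal ideal, then the ideal is locally principal. -/
theorem isLocallyPrincipal_of_forall_isMaximal {R : Type*} [CommRing R] {I : Ideal R}
    (h : ∀ p : Ideal R, p.IsMaximal → ∃ t ∉ p, ∃ i ∈ I, ∀ x ∈ I, t * x ∈ Ideal.span {i}) :
    I.IsLocallyPrincipal := by
  let A : Set R := {t | ∃ i ∈ I, ∀ x ∈ I, t * x ∈ Ideal.span {i}}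
  have hA : Ideal.span A = ⊤ := by
    by_contra hne
    obtain ⟨p, hp, hle⟩ := Ideal.exists_le_maximal _ hne
    obtain ⟨t, htp, ht⟩ := h p hp
    exact htp (hle (Ideal.subset_span ht))
  obtain ⟨s, hsA, hs⟩ := (Ideal.span_eq_top_iff_finite A).mp hA
  refine ⟨s, hs, fun t hts ↦ ?_⟩
  obtain ⟨i, hi, H⟩ := hsA hts
  refine ⟨algebraMap R _ i, le_antisymm (Ideal.map_le_iff_le_comap.mpr fun x hx ↦ ?_) ?_⟩
  · have hu : IsUnit (algebraMap R (Localization.Away t) t) :=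
      IsLocalization.Away.algebraMap_isUnit t
    obtain ⟨c, hc⟩ := Ideal.mem_span_singleton'.mp (H x hx)
    rw [Ideal.mem_comap, ← Ideal.span, ← Ideal.unit_mul_mem_iff_mem _ hu, ← map_mul, ← hc, map_mul]
    exact Ideal.mul_mem_left _ _ (Ideal.mem_span_singleton_self _)
  · rw [← Ideal.span, Ideal.span_singleton_le_iff_mem]
    exact Ideal.mem_map_of_mem _ hi

/-- A finitely generated ideal which is principal at each maximal ideal is locally principal. -/
theorem FG.isLocallyPrincipal {R : Type*} [CommRing R] {I : Ideal R} (hI : I.FG)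
    (h : ∀ (p : Ideal R) [p.IsMaximal],
      (I.map (algebraMap R (Localization.AtPrime p))).IsPrincipal) :
    I.IsLocallyPrincipal := by
  refine isLocallyPrincipal_of_forall_isMaximal fun p hp ↦ ?_
  obtain ⟨g, hg⟩ := h p
  rw [← Ideal.span] at hg
  have hgI : g ∈ I.map (algebraMap R (Localization.AtPrime p)) :=
    hg ▸ Ideal.mem_span_singleton_self g
  obtain ⟨⟨⟨i, hi⟩, u⟩, hgu⟩ := (IsLocalization.mem_map_algebraMap_iff p.primeCompl _).mp hgI
  have hle : I.map (algebraMap R (Localization.AtPrime p)) ≤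
      (Ideal.span {i}).map (algebraMap R (Localization.AtPrime p)) := by
    rw [hg, Ideal.map_span, Set.image_singleton, Ideal.span_singleton_le_iff_mem,
      ← Ideal.mul_unit_mem_iff_mem _ (IsLocalization.map_units (Localization.AtPrime p) u), hgu]
    exact Ideal.mem_span_singleton_self _
  have key : ∀ x ∈ I, ∃ m ∈ p.primeCompl, m * x ∈ Ideal.span {i} := fun x hx ↦
    (IsLocalization.algebraMap_mem_map_algebraMap_iff p.primeCompl
      (Localization.AtPrime p) _ _).mp (hle (Ideal.mem_map_of_mem _ hx))
  obtain ⟨s, rfl⟩ := hI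
  choose! m hm hmx using key
  -- The product of the multipliers of the finitely many generators works for all of `I` at once.
  refine ⟨∏ x ∈ s, m x, p.primeCompl.prod_mem fun x hx ↦ hm x (Ideal.subset_span hx), i, hi,
    fun x hx ↦ ?_⟩
  induction hx using Submodule.span_induction with
  | mem x hx =>
    obtain ⟨c, hc⟩ := Finset.dvd_prod_of_mem m hx
    rw [hc, mul_right_comm]
    exact Ideal.mul_mem_right _ _ (hmx x (Ideal.subset_span hx))
  | zero => simp
  | add x y _ _ hx hy => rw [mul_add]; exact add_mem hx hy
  | smul a x _ hx => rw [smul_eq_mul, mul_left_comm]; exact Ideal.mul_mem_left _ _ hx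

/-- An ideal which is free as a module is principal. -/
theorem isPrincipal_of_free {R : Type*} [CommRing R] (I : Ideal R) [Module.Free R I] :
    I.IsPrincipal := by
  nontriviality R
  let b := Module.Free.chooseBasis R I
  have hsub : Subsingleton (Module.Free.ChooseBasisIndex R I) := by
    refine ⟨fun i j ↦ by_contra fun hij ↦ ?_⟩
    -- Two distinct basis elements of an ideal would satisfy this nontrivial relation.
    have h0 : (b j : R) • b i = (b i : R) • b j := Subtype.ext (mul_comm _ _)
    have h1 := congrArg (fun x ↦ b.repr x i) h0
    have h2 : (b j : R) = 0 := by simpa [Finsupp.single_eq_of_ne hij] using h1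
    exact b.ne_zero j (Subtype.ext h2)
  rcases isEmpty_or_nonempty (Module.Free.ChooseBasisIndex R I) with he | ⟨⟨i⟩⟩
  · have : Subsingleton I := b.repr.toEquiv.subsingleton
    exact ⟨0, by simpa using (Submodule.subsingleton_iff_eq_bot).mp this⟩
  · refine ⟨(b i : R), le_antisymm (fun x hx ↦ ?_) ?_⟩
    · have := b.mem_span ⟨x, hx⟩
      rw [show Set.range b = {b i} from
        Set.eq_singleton_iff_unique_mem.mpr ⟨⟨i, rfl⟩, by
          rintro _ ⟨j, rfl⟩; rw [Subsingleton.elim j i]⟩] at this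
      obtain ⟨c, hc⟩ := Submodule.mem_span_singleton.mp this
      exact Submodule.mem_span_singleton.mpr ⟨c, congrArg Subtype.val hc⟩
    · rw [Submodule.span_singleton_le_iff_mem]
      exact (b i).2

end Ideal

section LocalRings

/-- A reduced local Bézout ring is a domain. -/
theorem IsBezout.isDomain_of_isLocalRing {R : Type*} [CommRing R] [IsLocalRing R] [IsBezout R]
    [IsReduced R] : IsDomain R := by
  have key : ∀ a b : R, a ∣ b → a * b = 0 → b = 0 := by
    rintro a _ ⟨c, rfl⟩ h
    refine eq_zero_of_pow_eq_zero (n := 2) ?_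
    linear_combination c * h
  have : NoZeroDivisors R := ⟨fun {a b} hab ↦ by
    obtain ⟨d, hd⟩ := (IsBezout.iff_span_pair_isPrincipal.mp ‹_›) a b
    rw [← Ideal.span] at hd
    obtain ⟨a', ha'⟩ := Ideal.mem_span_singleton'.mp
      (hd ▸ Ideal.subset_span (by simp) : a ∈ Ideal.span {d})
    obtain ⟨b', hb'⟩ := Ideal.mem_span_singleton'.mp
      (hd ▸ Ideal.subset_span (by simp) : b ∈ Ideal.span {d})
    obtain ⟨u, v, huv⟩ := Ideal.mem_span_pair.mp
      (hd ▸ Ideal.mem_span_singleton_self d : d ∈ Ideal.span {a, b})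
    -- By locality, either the second factor is a unit and `d = 0`, or `a'` or `b'` is a unit and
    -- one of `a`, `b` divides the other, so that `key` applies.
    have h0 : d * (1 - (u * a' + v * b')) = 0 := by
      linear_combination -huv - u * ha' - v * hb'
    rcases IsLocalRing.isUnit_or_isUnit_of_add_one
      (a := u * a' + v * b') (b := 1 - (u * a' + v * b')) (by ring) with h | h
    · rcases IsLocalRing.isUnit_or_isUnit_of_isUnit_add h with h | h
      · right
        refine key a b ?_ hab
        rw [← hb', ← ha']
        exact (isUnit_of_mul_isUnit_right h).mul_left_dvd.mpr (dvd_mul_left _ _)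
      · left
        refine key b a ?_ (mul_comm a b ▸ hab)
        rw [← hb', ← ha']
        exact (isUnit_of_mul_isUnit_right h).mul_left_dvd.mpr (dvd_mul_left _ _)
    · left
      rw [← ha', (h.mul_left_eq_zero).mp h0, mul_zero]⟩
  exact NoZeroDivisors.to_isDomain R

/-- The localizations of an arithmetic ring at primes are Bézout. -/
theorem IsArithmeticRing.isBezout_atPrime {R : Type*} [CommRing R] (hR : IsArithmeticRing R)
    (p : Ideal R) [p.IsPrime] : IsBezout (Localization.AtPrime p) := by
  refine IsBezout.iff_span_pair_isPrincipal.mpr fun x y ↦ ?_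
  obtain ⟨a, b, s, rfl, rfl⟩ :
      ∃ (a b : R) (s : p.primeCompl), IsLocalization.mk' _ a s = x ∧ IsLocalization.mk' _ b s = y := by
    obtain ⟨a, s, rfl⟩ := IsLocalization.exists_mk'_eq p.primeCompl x
    obtain ⟨b, t, rfl⟩ := IsLocalization.exists_mk'_eq p.primeCompl y
    exact ⟨a * t, b * s, s * t, IsLocalization.mk'_cancel _ _ _,
      by rw [mul_comm s t]; exact IsLocalization.mk'_cancel _ _ _⟩
  have h := (hR (Ideal.span {a, b}) (Submodule.fg_span (by simp))).isPrincipal_map_atPrime p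
  rw [Ideal.map_span, Set.image_pair] at h
  have hu : IsUnit (IsLocalization.mk' (Localization.AtPrime p) 1 s) :=
    IsUnit.of_mul_eq_one (algebraMap R _ s) (by simp)
  rwa [IsLocalization.mk'_eq_mul_mk'_one a, IsLocalization.mk'_eq_mul_mk'_one b,
    Ideal.span_insert, Ideal.span_singleton_mul_right_unit hu,
    Ideal.span_singleton_mul_right_unit hu, ← Ideal.span_insert]

/-- The localizations of a Prüfer ring at primes are domains. -/
theorem IsPruferRing.isDomain_atPrime {R : Type*} [CommRing R] (hR : IsPruferRing R)
    (p : Ideal R) [p.IsPrime] : IsDomain (Localization.AtPrime p) :=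
  have := hR.isReduced
  have := hR.isArithmetic.isBezout_atPrime p
  IsBezout.isDomain_of_isLocalRing

end LocalRings

section Flatness

/-- Submodules of flat modules over a Prüfer ring are flat. -/
theorem IsPruferRing.flat_submodule {R M : Type*} [CommRing R] (hR : IsPruferRing R)
    [AddCommGroup M] [Module R M] [Module.Flat R M] (N : Submodule R M) : Module.Flat R N := by
  refine Module.flat_of_localized_maximal _ fun p hp ↦ ?_
  have := hR.isArithmetic.isBezout_atPrime p
  have := hR.isDomain_atPrime p
  rw [← Module.flat_iff_of_isLocalization (Localization.AtPrime p) p.primeCompl]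
  rw [Module.Flat.flat_iff_torsion_eq_bot_of_isBezout, ← Submodule.isTorsionFree_iff_torsion_eq_bot]
  have hflat : Module.Flat (Localization.AtPrime p) (LocalizedModule p.primeCompl M) :=
    inferInstance
  exact (LocalizedModule.map_injective p.primeCompl N.subtype
    N.injective_subtype).moduleIsTorsionFree _ fun c x ↦ map_smul _ c x

variable {R : Type*} [CommRing R]

/-- The finitely generated ideals of a localization at a prime are free, if all ideals of the
base ring are flat. -/
theorem Ideal.free_atPrime_of_forall_flat (h : ∀ I : Ideal R, Module.Flat R I) (p : Ideal R)
    [p.IsPrime] {J : Ideal (Localization.AtPrime p)} (hJ : J.FG) :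
    Module.Free (Localization.AtPrime p) J := by
  have : Module.Finite (Localization.AtPrime p) J := Module.Finite.of_fg hJ
  suffices Module.Flat (Localization.AtPrime p) J from Module.free_of_flat_of_isLocalRing
  -- `J` is the localization of its contraction to `R`, which need not be finitely generated; hence
  -- flatness is assumed for all ideals.
  rw [← IsLocalization.map_under p.primeCompl (Localization.AtPrime p) J,
    ← Ideal.localized'_eq_map (Localization.AtPrime p) p.primeCompl]
  have := h (J.comap (algebraMap R _))
  exact Module.Flat.of_isLocalizedModule (Localization.AtPrime p) p.primeCompl
    (Submodule.toLocalized' (Localization.AtPrime p) p.primeCompl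
      (Algebra.linearMap R (Localization.AtPrime p)) (J.comap (algebraMap R _)))

/-- A ring all of whose ideals are flat is reduced. -/
theorem isReduced_of_forall_flat (h : ∀ I : Ideal R, Module.Flat R I) : IsReduced R := by
  refine isReduced_ofLocalizationMaximal R fun p hp ↦ ?_
  refine (isReduced_iff_pow_one_lt 2 one_lt_two).mpr fun a ha ↦ ?_
  have := Ideal.free_atPrime_of_forall_flat h p (J := Ideal.span {a}) (Submodule.fg_span (by simp))
  rcases subsingleton_or_nontrivial (Ideal.span {a}) with hs | hn
  · exact Ideal.span_singleton_eq_bot.mp (Submodule.subsingleton_iff_eq_bot.mp hs)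
  -- A nonzero free module is faithful, yet `a` kills `⟨a⟩` because `a ^ 2 = 0`.
  · refine FaithfulSMul.eq_of_smul_eq_smul (α := Ideal.span {a}) fun x ↦ Subtype.ext ?_
    obtain ⟨c, hc⟩ := Ideal.mem_span_singleton'.mp x.2
    simp only [SetLike.val_smul, smul_eq_mul, zero_smul, ZeroMemClass.coe_zero, ← hc]
    linear_combination c * ha

/-- A ring all of whose ideals are flat is a Prüfer ring. -/
theorem IsPruferRing.of_forall_flat (h : ∀ I : Ideal R, Module.Flat R I) : IsPruferRing R where
  isReduced := isReduced_of_forall_flat h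
  isArithmetic _ hI := hI.isLocallyPrincipal fun p _ ↦
    have := Ideal.free_atPrime_of_forall_flat h p (hI.map (algebraMap R (Localization.AtPrime p)))
    Ideal.isPrincipal_of_free _

variable {S : Type*} [CommRing S] [Algebra R S]

/-- A flat unramified algebra over a Prüfer ring is a Prüfer ring. -/
theorem IsPruferRing.of_flat_of_formallyUnramified (hR : IsPruferRing R) [Module.Flat R S]
    [Algebra.EssFiniteType R S] [Algebra.FormallyUnramified R S] : IsPruferRing S :=
  .of_forall_flat fun I ↦
    have : Module.Flat R I := hR.flat_submodule (I.restrictScalars R)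
    -- The reason is that the diagonal `S ⊗[R] S → S` is flat, and `N ⊗[S] I` is the base change of
    -- `N ⊗[R] I` along it.
    Algebra.FormallyUnramified.flat_of_restrictScalars R S I

/-- Quasi-finite algebras do not increase the Krull dimension. -/
theorem Ring.KrullDimLE.of_quasiFinite (n : ℕ) [Ring.KrullDimLE n R] [Algebra.QuasiFinite R S] :
    Ring.KrullDimLE n S := by
  rw [Ring.krullDimLE_iff]
  refine le_trans ?_ ((Ring.krullDimLE_iff (n := n) (R := R)).mp ‹_›)
  -- Distinct primes in one fibre are incomparable, so contraction keeps chains strict.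
  refine Order.krullDim_le_of_strictMono (PrimeSpectrum.comap (algebraMap R S)) fun p q hpq ↦ ?_
  refine lt_of_le_of_ne (Ideal.comap_mono hpq.le) fun heq ↦ hpq.ne (PrimeSpectrum.ext ?_)
  exact Algebra.QuasiFinite.eq_of_le_of_under_eq (R := R) _ _ hpq.le (congrArg (·.asIdeal) heq)

end Flatness

/-- The algebra `R_{f}` is étale over `R`. -/
theorem LocalizedRootAlgebra.etale {R : Type*} [CommRing R] {f : R[X]} (hf : f.Monic) :
    Algebra.Etale R (LocalizedRootAlgebra f) := by
  -- The entries `1, 0, 1` encode `f' * 1 + f * 0 = f' ^ 1`: the inverted element is `f'` itself.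
  let P : StandardEtalePair R := ⟨f, hf, derivative f, 1, 0, 1, by simp⟩
  unfold LocalizedRootAlgebra
  rw [AdjoinRoot.aeval_eq]
  exact Algebra.Etale.of_equiv P.equivAwayAdjoinRoot

theorem mainTheorem4 {R : Type*} [CommRing R] (hR : IsPruferRing R)
    (hdim : Ring.KrullDimLE 1 R) (f : Polynomial R) (hf : f.Monic) :
    IsPruferRing (LocalizedRootAlgebra f) ∧ Ring.KrullDimLE 1 (LocalizedRootAlgebra f) := by
  have := LocalizedRootAlgebra.etale hf
  have : Module.Flat R (LocalizedRootAlgebra f) := by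
    have := hf.free_adjoinRoot
    exact Module.Flat.trans R (AdjoinRoot f) _
  exact ⟨hR.of_flat_of_formallyUnramified, .of_quasiFinite (R := R) 1⟩
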